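/- For nonnegative integers $a,b,c$ let $E(a,b,c)$ be the number of block derangements for three players: three players originally hold $a$, $b$, $c$ distinguishable cards respectively, and $E(a,b,c)$ is the number of ways to redistribute all $a+b+c$ cards so that the players again receive $a$, $b$, $c$ cards respectively (the order of the cards within a hand is irrelevant) and no player receives a card that he held originally. **Theorem.** (1) Let $(a_i),(b_i),(c_i)$ be sequences of nonnegative integers tending to infinity proportionally, i.e. there are real numbers $\alpha,\beta,\gamma>0$ and real numbers $N_i\to\infty$ with $a_i/N_i\to\alpha$, $b_i/N_i\to\beta$, $c_i/N_i\to\gamma$. Suppose that for all sufficiently large $i$ the triangle inequalities $a_i\le b_i+c_i$, $b_i\le a_i+c_i$, $c_i\le a_i+b_i$ hold. Then, as $i\to\infty$, with $(a,b,c)=(a_i,b_i,c_i)$, $$E(a,b,c)\sim \frac{2^{a+b+c+1}}{\pi\sqrt{2ab+2ac+2bc-a^2-b^2-c^2}}\cdot\frac{a!\,b!\,c!}{(a+b-c)!\,(a-b+c)!\,(b-a+c)!}.$$ (2) In particular this gives the asymptotics of the Franel numbers: $E(n,n,n)=\sum_{k=0}^n\binom nk^3$ for all $n\ge 0$, and $\sum_{k=0}^n\binom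 nk^3\sim \dfrac{2^{3n+1}}{\sqrt3\,\pi n}$ as $n\to\infty$. -/

import Mathlib

open Filter Topology Asymptotics

/-- A way to deal the cards. Player `i` originally holds `n i` distinguishable cards, so that
`⟨i, k⟩ : Σ i, Fin (n i)` is the `k`-th card of player `i`; `f x` is the player who receives the
card `x`. No player receives a card that he held originally, and every player `i` again receives
`n i` cards. -/
def IsBlockDerangement {ι : Type*} [DecidableEq ι] (n : ι → ℕ) [Fintype (Σ i, Fin (n i))]
    (f : (Σ i, Fin (n i)) → ι) : Prop :=
  (∀ x, f x ≠ x.1) ∧ ∀ i, (Finset.univ.filter (fun x => f x = i)).card = n i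

/-- The number of block derangements with block sizes `n i` (the order in which a player receives
his cards is irrelevant). -/
noncomputable def blockDerangementCount {ι : Type*} [Fintype ι] [DecidableEq ι] (n : ι → ℕ) : ℕ :=
  Nat.card {f : (Σ i, Fin (n i)) → ι // IsBlockDerangement n f}

/-- The number `E(a, b, c)` of block derangements for three players. -/
noncomputable def blockDerangementCount₃ (a b c : ℕ) : ℕ :=
  blockDerangementCount ![a, b, c]

/-! A deal is determined by the cards each player passes to the cyclically next one, so E is a sum
of products of three binomials under balance conditions. Put p = a+b-c, q = a+c-b, r = b+c-a, so
that p+q = 2a, p+r = 2b, q+r = 2c. Regrouping factorials (`choose_mul_factorials`) gives E =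
a!b!c!/(p!q!r!) times the coefficient of u^a v^b in (1+uv)^p (1+u)^q (1+v)^r. By Fourier inversion
this coefficient is 2^(p+q+r)/(2π)^2 times the integral of cos((s+t)/2)^p cos(s/2)^q cos(t/2)^r over
a period square.

Rescaling by √N turns the integrand into a Gaussian, and dominated convergence gives N times the
integral → 8π/√(PQ+PR+QR), where P, Q, R are the limits of p/N, q/N, r/N. The radicand of the main
term is exactly pq+pr+qr.

Domination needs only Q, R > 0. Since P, Q, R have pairwise sums 2α, 2β, 2γ > 0, at most one
vanishes, and cyclic symmetry moves it to P; this covers degenerate triangles. -/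

/-! ### Deals as triples of finite sets -/

/-- The player to whom each card goes, when `S.1`, `S.2.1`, `S.2.2` are the sets of cards which
pass from each of the three players to the cyclically next one. -/
def dealOfFinsets {a b c : ℕ} (S : Finset (Fin a) × Finset (Fin b) × Finset (Fin c)) :
    (Σ i, Fin ((![a, b, c] : Fin 3 → ℕ) i)) → Fin 3
  | ⟨0, k⟩ => if (show Fin a from k) ∈ S.1 then 1 else 2
  | ⟨1, k⟩ => if (show Fin b from k) ∈ S.2.1 then 2 else 0
  | ⟨2, k⟩ => if (show Fin c from k) ∈ S.2.2 then 0 else 1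

/-- The sets of cards which pass from each of the three players to the cyclically next one. -/
def finsetsOfDeal {a b c : ℕ} (f : (Σ i, Fin ((![a, b, c] : Fin 3 → ℕ) i)) → Fin 3) :
    Finset (Fin a) × Finset (Fin b) × Finset (Fin c) :=
  (Finset.univ.filter fun k : Fin a => f ⟨0, k⟩ = 1,
    Finset.univ.filter fun k : Fin b => f ⟨1, k⟩ = 2,
    Finset.univ.filter fun k : Fin c => f ⟨2, k⟩ = 0)

theorem finsetsOfDeal_dealOfFinsets {a b c : ℕ}
    (S : Finset (Fin a) × Finset (Fin b) × Finset (Fin c)) :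
    finsetsOfDeal (dealOfFinsets S) = S := by
  obtain ⟨A, B, C⟩ := S
  simp [finsetsOfDeal, dealOfFinsets]

theorem dealOfFinsets_ne {a b c : ℕ} (S : Finset (Fin a) × Finset (Fin b) × Finset (Fin c))
    (x : Σ i, Fin ((![a, b, c] : Fin 3 → ℕ) i)) : dealOfFinsets S x ≠ x.1 := by
  obtain ⟨i, k⟩ := x
  fin_cases i <;> simp only [dealOfFinsets] <;> split_ifs <;> simp

theorem ite_mem_filter_eq {m : ℕ} (g : Fin m → Fin 3) (u v : Fin 3) (k : Fin m)
    (h : g k = u ∨ g k = v) :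
    (if k ∈ Finset.univ.filter (fun k => g k = u) then u else v) = g k := by
  simp only [Finset.mem_filter_univ]
  grind

theorem dealOfFinsets_finsetsOfDeal {a b c : ℕ}
    (f : (Σ i, Fin ((![a, b, c] : Fin 3 → ℕ) i)) → Fin 3) (hf : ∀ x, f x ≠ x.1) :
    dealOfFinsets (finsetsOfDeal f) = f := by
  funext ⟨i, k⟩
  have h := hf ⟨i, k⟩
  match i, k, h with
  | 0, k, h => exact ite_mem_filter_eq (m := a) (fun k => f ⟨0, k⟩) 1 2 k (by grind)
  | 1, k, h => exact ite_mem_filter_eq (m := b) (fun k => f ⟨1, k⟩) 2 0 k (by grind)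
  | 2, k, h => exact ite_mem_filter_eq (m := c) (fun k => f ⟨2, k⟩) 0 1 k (by grind)

theorem card_dealOfFinsets {a b c : ℕ} (S : Finset (Fin a) × Finset (Fin b) × Finset (Fin c))
    (j : Fin 3) :
    (Finset.univ.filter fun x => dealOfFinsets S x = j).card =
      ![(b - S.2.1.card) + S.2.2.card, S.1.card + (c - S.2.2.card),
        (a - S.1.card) + S.2.1.card] j := by
  obtain ⟨A, B, C⟩ := S
  have hcompl : ∀ {m : ℕ} (D : Finset (Fin m)),
      (Finset.univ.filter fun k => k ∉ D).card = m - D.card := by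
    intro m D
    rw [Finset.filter_not, Finset.filter_mem_eq_inter, Finset.univ_inter,
      ← Finset.compl_eq_univ_sdiff, Finset.card_compl, Fintype.card_fin]
  rw [Finset.card_filter, Fintype.sum_sigma, Fin.sum_univ_three]
  change (∑ k : Fin a, if (if k ∈ A then (1 : Fin 3) else 2) = j then 1 else 0) +
    (∑ k : Fin b, if (if k ∈ B then (2 : Fin 3) else 0) = j then 1 else 0) +
    (∑ k : Fin c, if (if k ∈ C then (0 : Fin 3) else 1) = j then 1 else 0) = _
  simp only [← Finset.card_filter]
  fin_cases j <;> simp [ite_eq_iff, hcompl]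

/-- Two balance conditions suffice: the third follows because the total number of cards is
preserved. -/
theorem isBlockDerangement_dealOfFinsets {a b c : ℕ}
    (S : Finset (Fin a) × Finset (Fin b) × Finset (Fin c)) :
    IsBlockDerangement ![a, b, c] (dealOfFinsets S) ↔
      S.2.2.card + b = a + S.2.1.card ∧ S.1.card + c = b + S.2.2.card := by
  have hA := card_finset_fin_le S.1
  have hB := card_finset_fin_le S.2.1
  have hC := card_finset_fin_le S.2.2
  simp only [IsBlockDerangement, card_dealOfFinsets, Fin.forall_fin_succ (n := 2)]
  simp
  constructor
  · rintro ⟨-, h0, h1, h2⟩; omega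
  · intro h
    exact ⟨fun x => dealOfFinsets_ne _ x, by omega⟩

theorem sum_finset_fin_card {M : Type*} [AddCommMonoid M] (n : ℕ) (f : ℕ → M) :
    ∑ S : Finset (Fin n), f S.card = ∑ x ∈ Finset.range (n + 1), n.choose x • f x := by
  simpa using Finset.sum_powerset_apply_card f (x := (Finset.univ : Finset (Fin n)))

theorem blockDerangementCount₃_eq_sum (a b c : ℕ) :
    blockDerangementCount₃ a b c =
      ∑ x ∈ Finset.range (a + 1), ∑ y ∈ Finset.range (b + 1), ∑ z ∈ Finset.range (c + 1),
        if z + b = a + y ∧ x + c = b + z then a.choose x * b.choose y * c.choose z else 0 := by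
  have e : {f : (Σ i, Fin ((![a, b, c] : Fin 3 → ℕ) i)) → Fin 3 //
      IsBlockDerangement ![a, b, c] f} ≃
      {S : Finset (Fin a) × Finset (Fin b) × Finset (Fin c) //
        S.2.2.card + b = a + S.2.1.card ∧ S.1.card + c = b + S.2.2.card} :=
    { toFun := fun f => ⟨finsetsOfDeal f.1, by
        rw [← isBlockDerangement_dealOfFinsets, dealOfFinsets_finsetsOfDeal _ f.2.1]
        exact f.2⟩
      invFun := fun S => ⟨dealOfFinsets S.1, (isBlockDerangement_dealOfFinsets _).2 S.2⟩
      left_inv := fun f => Subtype.ext (dealOfFinsets_finsetsOfDeal _ f.2.1)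
      right_inv := fun S => Subtype.ext (finsetsOfDeal_dealOfFinsets _) }
  rw [blockDerangementCount₃, blockDerangementCount, Nat.card_congr e, Nat.card_eq_fintype_card,
    Fintype.card_subtype, Finset.card_filter, Fintype.sum_prod_type]
  simp only [Fintype.sum_prod_type]
  rw [sum_finset_fin_card a (fun x => ∑ B : Finset (Fin b), ∑ C : Finset (Fin c),
    if C.card + b = a + B.card ∧ x + c = b + C.card then 1 else 0)]
  refine Finset.sum_congr rfl fun x _ => ?_
  rw [sum_finset_fin_card b (fun y => ∑ C : Finset (Fin c),
    if C.card + b = a + y ∧ x + c = b + C.card then 1 else 0), Finset.smul_sum]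
  refine Finset.sum_congr rfl fun y _ => ?_
  rw [sum_finset_fin_card c (fun z => if z + b = a + y ∧ x + c = b + z then 1 else 0),
    Finset.smul_sum, Finset.smul_sum]
  refine Finset.sum_congr rfl fun z _ => ?_
  split_ifs <;> simp [mul_assoc]

theorem blockDerangementCount₃_rotate (a b c : ℕ) :
    blockDerangementCount₃ a b c = blockDerangementCount₃ b c a := by
  rw [blockDerangementCount₃_eq_sum, blockDerangementCount₃_eq_sum, Finset.sum_comm]
  refine Finset.sum_congr rfl fun y _ => ?_
  rw [Finset.sum_comm]
  refine Finset.sum_congr rfl fun z _ => Finset.sum_congr rfl fun x _ => ?_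
  refine if_congr (by omega) (by ring) rfl

theorem blockDerangementCount₃_self (n : ℕ) :
    blockDerangementCount₃ n n n = ∑ k ∈ Finset.range (n + 1), n.choose k ^ 3 := by
  rw [blockDerangementCount₃_eq_sum]
  refine Finset.sum_congr rfl fun x hx => ?_
  rw [Finset.sum_eq_single_of_mem x hx, Finset.sum_eq_single_of_mem x hx]
  · rw [if_pos (by omega)]; ring
  · intro z _ hz; rw [if_neg (by omega)]
  · intro y _ hy
    refine Finset.sum_eq_zero fun z _ => if_neg (by omega)

/-! ### Regrouping factorials -/

/-- The coefficient of `u ^ a * v ^ b` in `(1 + u * v) ^ p * (1 + u) ^ q * (1 + v) ^ r`. -/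
def tripleChooseSum (p q r a b : ℕ) : ℕ :=
  ∑ x ∈ Finset.range (p + 1), ∑ y ∈ Finset.range (q + 1), ∑ z ∈ Finset.range (r + 1),
    if x + y = a ∧ x + z = b then p.choose x * q.choose y * r.choose z else 0

theorem add_choose_mul_factorials (m n : ℕ) :
    (m + n).choose m * m.factorial * n.factorial = (m + n).factorial := by
  simpa using Nat.choose_mul_factorial_mul_factorial (Nat.le_add_right m n)

/-- The six numbers x, p-x, y, q-y, z, r-z pair off with sums p, q, r, and in another pairing with
sums a, b, c. Both sides are a!b!c!p!q!r! divided by the product of their six factorials. -/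
theorem choose_mul_factorials (p q r x y z a b c : ℕ) (hxp : x ≤ p) (hyq : y ≤ q) (hzr : z ≤ r)
    (ha : x + y = a) (hb : x + z = b) (hp : p + q = 2 * a) (hq : p + r = 2 * b)
    (hr : q + r = 2 * c) :
    a.choose x * b.choose (b - (p - x)) * c.choose (c - z) *
        (p.factorial * q.factorial * r.factorial) =
      a.factorial * b.factorial * c.factorial * (p.choose x * q.choose y * r.choose z) := by
  obtain ⟨x', rfl⟩ := Nat.exists_eq_add_of_le hxp
  obtain ⟨y', rfl⟩ := Nat.exists_eq_add_of_le hyq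
  obtain ⟨z', rfl⟩ := Nat.exists_eq_add_of_le hzr
  have e1 : b - (x + x' - x) = z' := by omega
  have e2 : c - z = y' := by omega
  rw [e1, e2]
  have h1 := add_choose_mul_factorials x y
  have h2 := add_choose_mul_factorials z' x'
  have h3 := add_choose_mul_factorials y' z
  have h4 := add_choose_mul_factorials x x'
  have h5 := add_choose_mul_factorials y y'
  have h6 := add_choose_mul_factorials z z'
  rw [ha] at h1
  rw [show z' + x' = b by omega] at h2
  rw [show y' + z = c by omega] at h3
  rw [← h1, ← h2, ← h3, ← h4, ← h5, ← h6]
  ring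

theorem sum_range_ite_eq_sum_filter (m n k : ℕ) (P : ℕ → ℕ → ℕ → Prop)
    [∀ x y z, Decidable (P x y z)] (F : ℕ → ℕ → ℕ → ℕ) :
    (∑ x ∈ Finset.range m, ∑ y ∈ Finset.range n, ∑ z ∈ Finset.range k,
      if P x y z then F x y z else 0) =
    ∑ t ∈ (Finset.range m ×ˢ Finset.range n ×ˢ Finset.range k).filter
      (fun t => P t.1 t.2.1 t.2.2), F t.1 t.2.1 t.2.2 := by
  simp only [Finset.sum_filter, Finset.sum_product]

theorem blockDerangementCount₃_mul_factorials (p q r a b c : ℕ) (hp : p + q = 2 * a)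
    (hq : p + r = 2 * b) (hr : q + r = 2 * c) :
    blockDerangementCount₃ a b c * (p.factorial * q.factorial * r.factorial) =
      a.factorial * b.factorial * c.factorial * tripleChooseSum p q r a b := by
  rw [blockDerangementCount₃_eq_sum, tripleChooseSum,
    sum_range_ite_eq_sum_filter _ _ _ (fun x y z => z + b = a + y ∧ x + c = b + z)
      (fun x y z => a.choose x * b.choose y * c.choose z),
    sum_range_ite_eq_sum_filter _ _ _ (fun x y z => x + y = a ∧ x + z = b)
      (fun x y z => p.choose x * q.choose y * r.choose z), Finset.sum_mul, Finset.mul_sum]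
  symm
  -- On the support of the coefficient sum, b-(p-x) = r-z and c-z = q-y.
  refine Finset.sum_bij'
    (fun t _ => (t.1, b - (p - t.1), c - t.2.2)) (fun t _ => (t.1, a - t.1, c - t.2.2))
     ?_ ?_ ?_ ?_ ?_
  · rintro ⟨x, y, z⟩ h
    simp only [Finset.mem_filter, Finset.mem_product, Finset.mem_range] at h ⊢
    omega
  · rintro ⟨x, y, z⟩ h
    simp only [Finset.mem_filter, Finset.mem_product, Finset.mem_range] at h ⊢
    omega
  · rintro ⟨x, y, z⟩ h
    simp only [Finset.mem_filter, Finset.mem_product, Finset.mem_range] at h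
    refine Prod.ext ?_ (Prod.ext ?_ ?_) <;> dsimp only <;> omega
  · rintro ⟨x, y, z⟩ h
    simp only [Finset.mem_filter, Finset.mem_product, Finset.mem_range] at h
    refine Prod.ext ?_ (Prod.ext ?_ ?_) <;> dsimp only <;> omega
  · rintro ⟨x, y, z⟩ h
    simp only [Finset.mem_filter, Finset.mem_product, Finset.mem_range] at h ⊢
    exact (choose_mul_factorials p q r x y z a b c (by omega) (by omega) (by omega) (by omega)
      (by omega) hp hq hr).symm

/-! ### Fourier integral for the coefficient -/

open MeasureTheory in
theorem setIntegral_cexp_int_mul (m : ℤ) :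
    ∫ s in Set.Ioc (-Real.pi) Real.pi, Complex.exp (m * s * Complex.I) =
      if m = 0 then 2 * (Real.pi : ℂ) else 0 := by
  rw [← intervalIntegral.integral_of_le (by linarith [Real.pi_pos])]
  split_ifs with hm
  · subst hm
    simp
    ring
  · have hc : (m : ℂ) * Complex.I ≠ 0 :=
      mul_ne_zero (Int.cast_ne_zero.2 hm) Complex.I_ne_zero
    have h := integral_exp_mul_complex (a := -Real.pi) (b := Real.pi) hc
    have hper : Complex.exp (m * Complex.I * (Real.pi : ℝ)) =
        Complex.exp (m * Complex.I * ((-Real.pi : ℝ) : ℂ)) := by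
      rw [Complex.exp_eq_exp_iff_exists_int]
      exact ⟨m, by push_cast; ring⟩
    rw [hper, sub_self, zero_div] at h
    rw [← h]
    congr 1 with s
    ring_nf

theorem two_mul_cos_pow (p : ℕ) (x : ℂ) :
    (2 * Complex.cos x) ^ p =
      ∑ k ∈ Finset.range (p + 1), (p.choose k : ℂ) * Complex.exp ((2 * k - p) * x * Complex.I) := by
  have h : 2 * Complex.cos x =
      Complex.exp (-x * Complex.I) * (Complex.exp (2 * x * Complex.I) + 1) := by
    rw [Complex.two_cos, mul_add, ← Complex.exp_add, mul_one]
    ring_nf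
  rw [h, mul_pow, add_pow, Finset.mul_sum]
  refine Finset.sum_congr rfl fun k _ => ?_
  rw [one_pow, mul_one, ← Complex.exp_nat_mul, ← Complex.exp_nat_mul, ← mul_assoc,
    ← Complex.exp_add, mul_comm]
  ring_nf

/-- The integrand whose mean over a period square is, up to a power of two, `tripleChooseSum`. -/
noncomputable def tripleCos (p q r : ℕ) (z : ℝ × ℝ) : ℝ :=
  Real.cos ((z.1 + z.2) / 2) ^ p * Real.cos (z.1 / 2) ^ q * Real.cos (z.2 / 2) ^ r

/-- The period square. -/
def periodSquare : Set (ℝ × ℝ) :=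
  Set.Ioc (-Real.pi) Real.pi ×ˢ Set.Ioc (-Real.pi) Real.pi

/-- The half-angle frequencies combine to integers because p+q and p+r are even. -/
theorem two_pow_mul_tripleCos {p q r a b : ℕ} (hp : p + q = 2 * a) (hq : p + r = 2 * b)
    (z : ℝ × ℝ) :
    (((2 : ℝ) ^ (p + q + r) * tripleCos p q r z : ℝ) : ℂ) =
      ∑ x ∈ Finset.range (p + 1), ∑ y ∈ Finset.range (q + 1), ∑ w ∈ Finset.range (r + 1),
        ((p.choose x * q.choose y * r.choose w : ℕ) : ℂ) *
          (Complex.exp (((x + y - a : ℤ) : ℂ) * z.1 * Complex.I) *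
            Complex.exp (((x + w - b : ℤ) : ℂ) * z.2 * Complex.I)) := by
  have ha : (p : ℂ) + q = 2 * a := by exact_mod_cast hp
  have hb : (p : ℂ) + r = 2 * b := by exact_mod_cast hq
  have h : (((2 : ℝ) ^ (p + q + r) * tripleCos p q r z : ℝ) : ℂ) =
      (2 * Complex.cos ((z.1 + z.2) / 2)) ^ p * (2 * Complex.cos (z.1 / 2)) ^ q *
        (2 * Complex.cos (z.2 / 2)) ^ r := by
    simp only [tripleCos]
    push_cast
    ring
  rw [h, two_mul_cos_pow, two_mul_cos_pow, two_mul_cos_pow, Finset.sum_mul_sum, Finset.sum_mul]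
  refine Finset.sum_congr rfl fun x _ => ?_
  rw [Finset.sum_mul_sum]
  refine Finset.sum_congr rfl fun y _ => Finset.sum_congr rfl fun w _ => ?_
  rw [← Complex.exp_add]
  have e : ((x + y - a : ℤ) : ℂ) * z.1 * Complex.I + ((x + w - b : ℤ) : ℂ) * z.2 * Complex.I =
      (2 * x - p) * ((z.1 + z.2) / 2) * Complex.I + (2 * y - q) * (z.1 / 2) * Complex.I +
        (2 * w - r) * (z.2 / 2) * Complex.I := by
    push_cast
    linear_combination (z.1 / 2 * Complex.I) * ha + (z.2 / 2 * Complex.I) * hb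
  rw [e, Complex.exp_add, Complex.exp_add]
  push_cast
  ring

open MeasureTheory in
theorem setIntegral_tripleCos {p q r a b : ℕ} (hp : p + q = 2 * a) (hq : p + r = 2 * b) :
    (2 : ℝ) ^ (p + q + r) * ∫ z in periodSquare, tripleCos p q r z =
      (2 * Real.pi) ^ 2 * tripleChooseSum p q r a b := by
  have hint : ∀ (m n : ℤ) (C : ℂ), IntegrableOn (fun z : ℝ × ℝ =>
      C * (Complex.exp (m * z.1 * Complex.I) * Complex.exp (n * z.2 * Complex.I)))
      periodSquare := by
    intro m n C
    refine (Continuous.integrableOn_Icc (a := ((-Real.pi, -Real.pi) : ℝ × ℝ))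
      (b := (Real.pi, Real.pi)) (by fun_prop)).mono_set ?_
    rw [← Set.Icc_prod_Icc]
    exact Set.prod_mono Set.Ioc_subset_Icc_self Set.Ioc_subset_Icc_self
  rw [← integral_const_mul, ← Complex.ofReal_inj, ← integral_complex_ofReal]
  simp only [two_pow_mul_tripleCos hp hq]
  rw [integral_finsetSum _ fun x _ => integrable_finsetSum _ fun y _ =>
    integrable_finsetSum _ fun w _ => hint _ _ _]
  push_cast [tripleChooseSum]
  rw [Finset.mul_sum]
  refine Finset.sum_congr rfl fun x _ => ?_
  rw [integral_finsetSum _ fun y _ => integrable_finsetSum _ fun w _ => by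
    exact_mod_cast hint (x + y - a) (x + w - b) _, Finset.mul_sum]
  refine Finset.sum_congr rfl fun y _ => ?_
  rw [integral_finsetSum _ fun w _ => by exact_mod_cast hint (x + y - a) (x + w - b) _,
    Finset.mul_sum]
  refine Finset.sum_congr rfl fun w _ => ?_
  have h1 := setIntegral_cexp_int_mul (x + y - a)
  have h2 := setIntegral_cexp_int_mul (x + w - b)
  push_cast at h1 h2
  rw [integral_const_mul, periodSquare, Measure.volume_eq_prod,
    setIntegral_prod_mul (fun s : ℝ => Complex.exp ((x + y - a) * s * Complex.I))
      (fun s : ℝ => Complex.exp ((x + w - b) * s * Complex.I)), h1, h2]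
  have e1 : ((x : ℤ) + y - a = 0) ↔ x + y = a := by omega
  have e2 : ((x : ℤ) + w - b = 0) ↔ x + w = b := by omega
  simp only [e1, e2]
  by_cases h : x + y = a <;> by_cases h' : x + w = b <;> simp [h, h']
  ring

/-! ### Gaussian limit of the integral -/

open MeasureTheory in
theorem integral_exp_quadratic {P Q R : ℝ} (hP : 0 ≤ P) (hQ : 0 < Q) (hR : 0 < R) :
    ∫ z : ℝ × ℝ, Real.exp (-P * (z.1 + z.2) ^ 2 / 8) * Real.exp (-Q * z.1 ^ 2 / 8) *
        Real.exp (-R * z.2 ^ 2 / 8) = 8 * Real.pi / √(P * Q + P * R + Q * R) := by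
  have hint : Integrable (fun z : ℝ × ℝ => Real.exp (-P * (z.1 + z.2) ^ 2 / 8) *
      Real.exp (-Q * z.1 ^ 2 / 8) * Real.exp (-R * z.2 ^ 2 / 8)) (volume.prod volume) := by
    refine ((integrable_exp_neg_mul_sq (b := Q / 8) (by positivity)).mul_prod
      (integrable_exp_neg_mul_sq (b := R / 8) (by positivity))).mono'
      (by fun_prop) (ae_of_all _ fun z => ?_)
    rw [Real.norm_of_nonneg (by positivity), mul_assoc]
    refine (mul_le_of_le_one_left (by positivity) ?_).trans_eq ?_
    · rw [Real.exp_le_one_iff]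
      have := mul_nonneg hP (sq_nonneg (z.1 + z.2))
      linarith
    · ring_nf
  have hC : 0 < P + R := by positivity
  have hD : 0 < P * Q + P * R + Q * R := by positivity
  rw [Measure.volume_eq_prod, integral_prod _ hint]
  have inner : ∀ s : ℝ, ∫ u : ℝ, Real.exp (-P * (s + u) ^ 2 / 8) * Real.exp (-Q * s ^ 2 / 8) *
        Real.exp (-R * u ^ 2 / 8) =
      √(Real.pi / ((P + R) / 8)) *
        Real.exp (-((P * Q + P * R + Q * R) / (P + R) / 8) * s ^ 2) := by
    intro s
    -- Translating u by Ps/(P+R) completes the square.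
    rw [← integral_gaussian, ← integral_add_right_eq_self (fun u : ℝ =>
        Real.exp (-((P + R) / 8) * u ^ 2)) (P * s / (P + R)),
      ← integral_mul_const]
    congr 1 with u
    rw [← Real.exp_add, ← Real.exp_add, ← Real.exp_add]
    congr 1
    field_simp
    ring
  simp only [inner]
  rw [integral_const_mul, integral_gaussian, ← Real.sqrt_mul (by positivity)]
  rw [show Real.pi / ((P + R) / 8) * (Real.pi / ((P * Q + P * R + Q * R) / (P + R) / 8)) =
    (8 * Real.pi) ^ 2 / (P * Q + P * R + Q * R) by field_simp]
  rw [Real.sqrt_div (by positivity), Real.sqrt_sq (by positivity)]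

/-- Writing the quotient as `sinc` keeps the identity valid at h = 0, so limits along h → 0 need not
exclude zeros of h. -/
theorem Real.one_sub_cos_eq_sinc_sq (h : ℝ) :
    1 - Real.cos h = h ^ 2 / 2 * Real.sinc (h / 2) ^ 2 := by
  have h1 := Real.cos_two_mul' (h / 2)
  have h2 := Real.sin_sq_add_cos_sq (h / 2)
  rw [show 2 * (h / 2) = h by ring] at h1
  by_cases h0 : h = 0
  · simp [h0]
  · rw [Real.sinc_of_ne_zero (by simpa using h0)]
    field_simp
    linarith

theorem tendsto_cos_pow_of_tendsto_mul_sq {ι : Type*} {l : Filter ι} {h : ι → ℝ} {q : ι → ℕ}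
    {t : ℝ} (hh : Tendsto h l (𝓝 0)) (hq : Tendsto (fun i => q i * h i ^ 2) l (𝓝 t)) :
    Tendsto (fun i => Real.cos (h i) ^ q i) l (𝓝 (Real.exp (-t / 2))) := by
  have hcos : Tendsto (fun i => Real.cos (h i)) l (𝓝 1) := by
    simpa [Function.comp_def] using (Real.continuous_cos.tendsto 0).comp hh
  have hsinc : Tendsto (fun i => Real.sinc (h i / 2)) l (𝓝 1) := by
    simpa [Function.comp_def] using (Real.continuous_sinc.tendsto 0).comp (by simpa using hh.div_const 2)
  have hpos : ∀ᶠ i in l, 0 < Real.cos (h i) := hcos.eventually (lt_mem_nhds one_pos)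
  have hupper : Tendsto (fun i => q i * (Real.cos (h i) - 1)) l (𝓝 (-t / 2)) := by
    have := ((hq.div_const 2).mul (hsinc.pow 2)).neg
    simp only [one_pow, mul_one] at this
    rw [neg_div]
    refine this.congr fun i => ?_
    rw [← neg_sub 1, Real.one_sub_cos_eq_sinc_sq]
    ring
  have hlower : Tendsto (fun i => q i * (1 - (Real.cos (h i))⁻¹)) l (𝓝 (-t / 2)) := by
    have := hupper.mul (hcos.inv₀ one_ne_zero)
    simp only [inv_one, mul_one] at this
    refine this.congr' (hpos.mono fun i hi => ?_)
    field_simp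
  -- Squeeze by 1 - 1/x ≤ log x ≤ x - 1 at x = cos h.
  have hlog : Tendsto (fun i => q i * Real.log (Real.cos (h i))) l (𝓝 (-t / 2)) := by
    refine tendsto_of_tendsto_of_tendsto_of_le_of_le' hlower hupper
      (hpos.mono fun i hi => ?_) (hpos.mono fun i hi => ?_)
    · exact mul_le_mul_of_nonneg_left (Real.one_sub_inv_le_log_of_pos hi) (Nat.cast_nonneg _)
    · exact mul_le_mul_of_nonneg_left (Real.log_le_sub_one_of_pos hi) (Nat.cast_nonneg _)
  refine ((Real.continuous_exp.tendsto _).comp hlog).congr' (hpos.mono fun i hi => ?_)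
  simp only [Function.comp]
  rw [mul_comm, ← Real.rpow_def_of_pos hi, Real.rpow_natCast]

/-- The quadratic bound cos y ≤ 1 - 2y²/π² holds on all of |y| ≤ π, so one Gaussian dominates over
the whole period and no separate tail estimate is needed. -/
theorem cos_pow_le_exp {x : ℝ} (hx : |x| ≤ Real.pi) (q : ℕ) :
    |Real.cos (x / 2) ^ q| ≤ Real.exp (-(q * x ^ 2) / (2 * Real.pi ^ 2)) := by
  have hx2 : |x / 2| ≤ Real.pi / 2 := by
    rw [abs_div, abs_two]
    linarith
  have hnonneg : 0 ≤ Real.cos (x / 2) :=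
    Real.cos_nonneg_of_mem_Icc (by simpa [Set.mem_Icc] using abs_le.1 hx2)
  have hle : Real.cos (x / 2) ≤ Real.exp (-x ^ 2 / (2 * Real.pi ^ 2)) := by
    have h1 := Real.cos_le_one_sub_mul_cos_sq (x := x / 2) (by linarith [Real.pi_pos])
    have h2 := Real.add_one_le_exp (-x ^ 2 / (2 * Real.pi ^ 2))
    refine h1.trans (le_trans (le_of_eq ?_) h2)
    field_simp
    ring
  rw [abs_of_nonneg (pow_nonneg hnonneg q)]
  refine (pow_le_pow_left₀ hnonneg hle q).trans_eq ?_
  rw [← Real.exp_nat_mul]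
  ring_nf

open MeasureTheory in
theorem tendsto_mul_setIntegral_tripleCos {P Q R : ℝ} {N : ℕ → ℝ} {p q r : ℕ → ℕ}
    (hP : 0 ≤ P) (hQ : 0 < Q) (hR : 0 < R) (hN : Tendsto N atTop atTop)
    (hp : Tendsto (fun i => p i / N i) atTop (𝓝 P))
    (hq : Tendsto (fun i => q i / N i) atTop (𝓝 Q))
    (hr : Tendsto (fun i => r i / N i) atTop (𝓝 R)) :
    Tendsto (fun i => N i * ∫ z in periodSquare, tripleCos (p i) (q i) (r i) z) atTop
      (𝓝 (8 * Real.pi / √(P * Q + P * R + Q * R))) := by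
  have hpi := Real.pi_pos
  have hmeas : MeasurableSet periodSquare := measurableSet_Ioc.prod measurableSet_Ioc
  have hN0 : ∀ᶠ i in atTop, 0 < N i := hN.eventually_gt_atTop 0
  have hinv : Tendsto (fun i => (√(N i))⁻¹) atTop (𝓝 0) :=
    tendsto_inv_atTop_zero.comp (Real.tendsto_sqrt_atTop.comp hN)
  -- Dilation by √N in the plane has Jacobian N.
  have hscale : ∀ᶠ i in atTop,
      ∫ z, periodSquare.indicator (tripleCos (p i) (q i) (r i)) ((√(N i))⁻¹ • z) =
        N i * ∫ z in periodSquare, tripleCos (p i) (q i) (r i) z := by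
    filter_upwards [hN0] with i hi
    rw [Measure.integral_comp_inv_smul_of_nonneg _ _ (Real.sqrt_nonneg _),
      integral_indicator hmeas]
    simp [Real.sq_sqrt hi.le]
  refine Tendsto.congr' hscale ?_
  rw [← integral_exp_quadratic hP hQ hR]
  -- Eventually q/N > Q/2 and r/N > R/2; halving Q and R in the bound with 1/(2π²) gives the
  -- constants 1/(4π²).
  refine tendsto_integral_filter_of_dominated_convergence
    (fun z : ℝ × ℝ => Real.exp (-(Q / (4 * Real.pi ^ 2)) * z.1 ^ 2) *
      Real.exp (-(R / (4 * Real.pi ^ 2)) * z.2 ^ 2)) ?_ ?_ ?_ ?_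
  · refine Eventually.of_forall fun i => ?_
    have : Measurable (tripleCos (p i) (q i) (r i)) := by
      unfold tripleCos
      fun_prop
    exact ((this.indicator hmeas).comp (measurable_const_smul _)).aestronglyMeasurable
  · have hbound : ∀ {K c x : ℝ} {k : ℕ}, 0 < c → K / 2 < k / c →
        -(k * ((√c)⁻¹ * x) ^ 2) / (2 * Real.pi ^ 2) ≤ -(K / (4 * Real.pi ^ 2)) * x ^ 2 := by
      intro K c x k hc hk
      rw [mul_pow, inv_pow, Real.sq_sqrt hc.le]
      have := mul_le_mul_of_nonneg_right hk.le (by positivity : 0 ≤ x ^ 2 / (2 * Real.pi ^ 2))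
      calc -(k * (c⁻¹ * x ^ 2)) / (2 * Real.pi ^ 2)
          = -(k / c * (x ^ 2 / (2 * Real.pi ^ 2))) := by ring
        _ ≤ -(K / 2 * (x ^ 2 / (2 * Real.pi ^ 2))) := neg_le_neg this
        _ = _ := by ring
    filter_upwards [hN0, hq.eventually (lt_mem_nhds (half_lt_self hQ)),
      hr.eventually (lt_mem_nhds (half_lt_self hR))] with i hi hqi hri
    refine ae_of_all _ fun z => ?_
    by_cases hz : (√(N i))⁻¹ • z ∈ periodSquare
    · rw [Set.indicator_of_mem hz, Real.norm_eq_abs]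
      obtain ⟨⟨h1, h2⟩, h3, h4⟩ := hz
      simp only [tripleCos, abs_mul]
      -- The p-factor is only bounded by 1: P may be 0, and |cos((s+t)/2)| returns to 1 at the
      -- corner s = t = π.
      have hc : |Real.cos (((√(N i))⁻¹ • z).1 / 2 + ((√(N i))⁻¹ • z).2 / 2) ^ p i| ≤ 1 := by
        rw [abs_pow]
        exact pow_le_one₀ (abs_nonneg _) (Real.abs_cos_le_one _)
      rw [← add_div] at hc
      have hq' := cos_pow_le_exp (abs_le.2 ⟨h1.le, h2⟩) (q i)
      have hr' := cos_pow_le_exp (abs_le.2 ⟨h3.le, h4⟩) (r i)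
      refine mul_le_mul ((mul_le_of_le_one_left (abs_nonneg _) hc).trans (hq'.trans ?_))
        (hr'.trans ?_) (abs_nonneg _) (Real.exp_nonneg _)
      · exact Real.exp_le_exp.2 (hbound hi hqi)
      · exact Real.exp_le_exp.2 (hbound hi hri)
    · rw [Set.indicator_of_notMem hz, norm_zero]
      positivity
  · exact (integrable_exp_neg_mul_sq (by positivity)).mul_prod
      (integrable_exp_neg_mul_sq (by positivity))
  · refine ae_of_all _ fun z => ?_
    have hcos : ∀ {K x : ℝ} {k : ℕ → ℕ}, Tendsto (fun i => k i / N i) atTop (𝓝 K) →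
        Tendsto (fun i => Real.cos ((√(N i))⁻¹ * x / 2) ^ k i) atTop
          (𝓝 (Real.exp (-K * x ^ 2 / 8))) := by
      intro K x k hk
      have h0 : Tendsto (fun i => (√(N i))⁻¹ * x / 2) atTop (𝓝 0) := by
        simpa using (hinv.mul_const x).div_const 2
      have := tendsto_cos_pow_of_tendsto_mul_sq (q := k) (t := K * (x ^ 2 / 4)) h0
        ((hk.mul_const (x ^ 2 / 4)).congr' (hN0.mono fun i hi => by
          beta_reduce
          rw [div_pow, mul_pow, inv_pow, Real.sq_sqrt hi.le]
          ring))
      convert this using 3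
      ring
    have hmem : ∀ᶠ i in atTop, (√(N i))⁻¹ • z ∈ periodSquare := by
      have h0 : Tendsto (fun i => (√(N i))⁻¹ • z) atTop (𝓝 0) := by
        simpa using hinv.smul_const z
      refine h0.eventually_mem (prod_mem_nhds ?_ ?_) <;>
        exact Ioc_mem_nhds (by simpa using hpi) hpi
    refine (((hcos hp).mul (hcos hq)).mul (hcos hr)).congr' (hmem.mono fun i hi => ?_)
    beta_reduce
    rw [Set.indicator_of_mem hi]
    simp [tripleCos, mul_add]

/-! ### Assembling the asymptotics -/

/-- The main term in the asymptotics of `blockDerangementCount₃ a b c`. -/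
noncomputable def blockDerangementMainTerm (a b c : ℕ) : ℝ :=
  (2 : ℝ) ^ (a + b + c + 1) /
      (Real.pi * Real.sqrt
        (2 * (a : ℝ) * b + 2 * (a : ℝ) * c + 2 * (b : ℝ) * c
          - (a : ℝ) ^ 2 - (b : ℝ) ^ 2 - (c : ℝ) ^ 2)) *
    ((a.factorial : ℝ) * b.factorial * c.factorial /
      (((a + b - c).factorial : ℝ) * (a + c - b).factorial * (b + c - a).factorial))

theorem blockDerangementMainTerm_rotate (a b c : ℕ) :
    blockDerangementMainTerm a b c = blockDerangementMainTerm b c a := by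
  unfold blockDerangementMainTerm
  rw [show b + c + a + 1 = a + b + c + 1 by omega, show b + a - c = a + b - c by omega,
    show c + a - b = a + c - b by omega]
  ring_nf

theorem blockDerangementCount₃_eq_integral {a b c : ℕ}
    (h : a ≤ b + c ∧ b ≤ a + c ∧ c ≤ a + b) :
    (blockDerangementCount₃ a b c : ℝ) =
      2 ^ (a + b + c) / (2 * Real.pi) ^ 2 *
        (∫ z in periodSquare, tripleCos (a + b - c) (a + c - b) (b + c - a) z) *
        ((a.factorial : ℝ) * b.factorial * c.factorial /
          (((a + b - c).factorial : ℝ) * (a + c - b).factorial * (b + c - a).factorial)) := by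
  have hpi := Real.pi_pos
  have hp : (a + b - c) + (a + c - b) = 2 * a := by omega
  have hq : (a + b - c) + (b + c - a) = 2 * b := by omega
  have h1 := blockDerangementCount₃_mul_factorials _ _ _ a b c hp hq (by omega)
  have h2 := setIntegral_tripleCos hp hq
  rw [show a + b - c + (a + c - b) + (b + c - a) = a + b + c by omega] at h2
  have h1' := congrArg (Nat.cast : ℕ → ℝ) h1
  push_cast at h1'
  have hf : (((a + b - c).factorial : ℝ) * (a + c - b).factorial * (b + c - a).factorial) ≠ 0 := by
    positivity
  rw [div_mul_eq_mul_div, h2, mul_div_cancel_left₀ _ (by positivity), mul_div_assoc',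
    eq_div_iff hf, h1']
  ring

theorem blockDerangementCount₃_isEquivalent_of_pos {α β γ : ℝ} {N : ℕ → ℝ} {a b c : ℕ → ℕ}
    (hN : Tendsto N atTop atTop)
    (ha : Tendsto (fun i => (a i : ℝ) / N i) atTop (𝓝 α))
    (hb : Tendsto (fun i => (b i : ℝ) / N i) atTop (𝓝 β))
    (hc : Tendsto (fun i => (c i : ℝ) / N i) atTop (𝓝 γ))
    (htri : ∀ᶠ i in atTop, a i ≤ b i + c i ∧ b i ≤ a i + c i ∧ c i ≤ a i + b i)
    (hP : 0 ≤ α + β - γ) (hQ : 0 < α + γ - β) (hR : 0 < β + γ - α) :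
    (fun i => (blockDerangementCount₃ (a i) (b i) (c i) : ℝ)) ~[atTop]
      (fun i => blockDerangementMainTerm (a i) (b i) (c i)) := by
  have hpi := Real.pi_pos
  -- X is the limit of D/N², where D is the radicand of the main term; two positive factors keep it
  -- positive even if P = 0.
  set X := (α + β - γ) * (α + γ - β) + (α + β - γ) * (β + γ - α) + (α + γ - β) * (β + γ - α)
    with hX
  have hX0 : 0 < X := by positivity
  have hsub : ∀ {x y z : ℕ → ℕ} {ξ η ζ : ℝ}, Tendsto (fun i => (x i : ℝ) / N i) atTop (𝓝 ξ) →
      Tendsto (fun i => (y i : ℝ) / N i) atTop (𝓝 η) →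
      Tendsto (fun i => (z i : ℝ) / N i) atTop (𝓝 ζ) → (∀ᶠ i in atTop, z i ≤ x i + y i) →
      Tendsto (fun i => ((x i + y i - z i : ℕ) : ℝ) / N i) atTop (𝓝 (ξ + η - ζ)) := by
    intro x y z ξ η ζ hx hy hz h
    refine ((hx.add hy).sub hz).congr' (h.mono fun i hi => ?_)
    beta_reduce
    rw [Nat.cast_sub hi, Nat.cast_add]
    ring
  have hI := tendsto_mul_setIntegral_tripleCos hP hQ hR hN
    (hsub ha hb hc (htri.mono fun i h => h.2.2)) (hsub ha hc hb (htri.mono fun i h => h.2.1))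
    (hsub hb hc ha (htri.mono fun i h => h.1))
  set D : ℕ → ℝ := fun i => 2 * (a i : ℝ) * b i + 2 * (a i : ℝ) * c i + 2 * (b i : ℝ) * c i
    - (a i : ℝ) ^ 2 - (b i : ℝ) ^ 2 - (c i : ℝ) ^ 2 with hD
  have hDlim : Tendsto (fun i => D i / N i ^ 2) atTop (𝓝 X) := by
    have := (((((ha.mul hb).add (ha.mul hc)).add (hb.mul hc)).const_mul 2).sub (ha.pow 2)).sub
      (hb.pow 2) |>.sub (hc.pow 2)
    convert this using 2
    · simp only [hD]
      ring
    · rw [hX]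
      ring
  have hN0 : ∀ᶠ i in atTop, 0 < N i := hN.eventually_gt_atTop 0
  have hDpos : ∀ᶠ i in atTop, 0 < D i := by
    filter_upwards [hDlim.eventually (lt_mem_nhds hX0), hN0] with i h1 h2
    exact (div_pos_iff_of_pos_right (by positivity)).1 h1
  have hsqrt : Tendsto (fun i => √(D i) / N i) atTop (𝓝 √X) := by
    refine ((Real.continuous_sqrt.tendsto X).comp hDlim).congr' (hN0.mono fun i hi => ?_)
    rw [Function.comp, Real.sqrt_div' _ (by positivity), Real.sqrt_sq hi.le]
  have hmain : ∀ᶠ i in atTop, blockDerangementMainTerm (a i) (b i) (c i) ≠ 0 := by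
    filter_upwards [hDpos] with i hi
    have : 0 < √(D i) := Real.sqrt_pos.2 hi
    unfold blockDerangementMainTerm
    positivity
  rw [isEquivalent_iff_tendsto_one hmain]
  -- The ratio E / main term is the integral times √D/(8π), with 8π = 2(2π)²/π.
  have hlim := (hI.mul hsqrt).div_const (8 * Real.pi)
  rw [div_mul_cancel₀ _ (Real.sqrt_pos.2 hX0).ne', div_self (by positivity)] at hlim
  refine hlim.congr' ?_
  filter_upwards [htri, hDpos, hN0] with i hi hDi hNi
  have hs : 0 < √(D i) := Real.sqrt_pos.2 hDi
  rw [Pi.div_apply, blockDerangementCount₃_eq_integral hi, blockDerangementMainTerm,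
    mul_div_mul_right _ _ (by positivity)]
  change _ = _ / (_ / (Real.pi * √(D i)))
  rw [pow_succ]
  field_simp
  ring

theorem blockDerangementCount₃_isEquivalent {α β γ : ℝ} {N : ℕ → ℝ} {a b c : ℕ → ℕ}
    (hα : 0 < α) (hβ : 0 < β) (hγ : 0 < γ) (hN : Tendsto N atTop atTop)
    (ha : Tendsto (fun i => (a i : ℝ) / N i) atTop (𝓝 α))
    (hb : Tendsto (fun i => (b i : ℝ) / N i) atTop (𝓝 β))
    (hc : Tendsto (fun i => (c i : ℝ) / N i) atTop (𝓝 γ))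
    (htri : ∀ᶠ i in atTop, a i ≤ b i + c i ∧ b i ≤ a i + c i ∧ c i ≤ a i + b i) :
    (fun i => (blockDerangementCount₃ (a i) (b i) (c i) : ℝ)) ~[atTop]
      (fun i => blockDerangementMainTerm (a i) (b i) (c i)) := by
  have hle : ∀ {x y z : ℕ → ℕ} {ξ η ζ : ℝ}, Tendsto (fun i => (x i : ℝ) / N i) atTop (𝓝 ξ) →
      Tendsto (fun i => (y i : ℝ) / N i) atTop (𝓝 η) →
      Tendsto (fun i => (z i : ℝ) / N i) atTop (𝓝 ζ) → (∀ᶠ i in atTop, z i ≤ x i + y i) →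
      0 ≤ ξ + η - ζ := by
    intro x y z ξ η ζ hx hy hz h
    refine sub_nonneg.2 (le_of_tendsto_of_tendsto hz (hx.add hy) ?_)
    filter_upwards [h, hN.eventually_gt_atTop 0] with i hi hNi
    rw [← add_div]
    gcongr
    exact_mod_cast hi
  have hP := hle ha hb hc (htri.mono fun i h => h.2.2)
  have hQ := hle ha hc hb (htri.mono fun i h => h.2.1)
  have hR := hle hb hc ha (htri.mono fun i h => h.1)
  -- If Q or R vanishes, the rotation putting it in the role of P leaves the other two positive.
  rcases hR.lt_or_eq with hR' | hR'
  · rcases hQ.lt_or_eq with hQ' | hQ'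
    · exact blockDerangementCount₃_isEquivalent_of_pos hN ha hb hc htri hP hQ' hR'
    · have := blockDerangementCount₃_isEquivalent_of_pos hN hc ha hb
        (htri.mono fun i h => by omega) (by linarith) (by linarith) (by linarith)
      simpa only [blockDerangementCount₃_rotate, blockDerangementMainTerm_rotate (c _)] using this
  · have := blockDerangementCount₃_isEquivalent_of_pos hN hb hc ha
      (htri.mono fun i h => by omega) (by linarith) (by linarith) (by linarith)
    simpa only [← blockDerangementCount₃_rotate (a _), ← blockDerangementMainTerm_rotate (a _)]
      using this

/-! ### Franel numbers -/

theorem blockDerangementMainTerm_self (n : ℕ) :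
    blockDerangementMainTerm n n n = (2 : ℝ) ^ (3 * n + 1) / (√3 * Real.pi * n) := by
  unfold blockDerangementMainTerm
  -- For equal blocks the factorial quotient is 1; at n = 0 both sides are 0 by division by zero.
  rw [Nat.add_sub_cancel, div_self (by positivity), mul_one,
    show n + n + n + 1 = 3 * n + 1 by omega,
    show 2 * (n : ℝ) * n + 2 * (n : ℝ) * n + 2 * (n : ℝ) * n - (n : ℝ) ^ 2 - (n : ℝ) ^ 2
      - (n : ℝ) ^ 2 = 3 * (n : ℝ) ^ 2 by ring,
    Real.sqrt_mul (by norm_num), Real.sqrt_sq (Nat.cast_nonneg n)]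
  ring

theorem sum_choose_pow_three_isEquivalent :
    (fun n : ℕ => ((∑ k ∈ Finset.range (n + 1), n.choose k ^ 3 : ℕ) : ℝ)) ~[atTop]
      (fun n : ℕ => (2 : ℝ) ^ (3 * n + 1) / (√3 * Real.pi * n)) := by
  have h1 : Tendsto (fun n : ℕ => (n : ℝ) / n) atTop (𝓝 1) :=
    tendsto_const_nhds.congr' <| (eventually_gt_atTop 0).mono fun n hn =>
      (div_self (Nat.cast_ne_zero.2 hn.ne')).symm
  have h := blockDerangementCount₃_isEquivalent one_pos one_pos one_pos
    tendsto_natCast_atTop_atTop h1 h1 h1 (Eventually.of_forall fun n => by omega)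
  simpa only [blockDerangementCount₃_self, blockDerangementMainTerm_self] using h

theorem mainTheorem8 :
    (∀ (α β γ : ℝ) (N : ℕ → ℝ) (a b c : ℕ → ℕ),
      0 < α → 0 < β → 0 < γ →
      Tendsto N atTop atTop →
      Tendsto (fun i => (a i : ℝ) / N i) atTop (𝓝 α) →
      Tendsto (fun i => (b i : ℝ) / N i) atTop (𝓝 β) →
      Tendsto (fun i => (c i : ℝ) / N i) atTop (𝓝 γ) →
      (∀ᶠ i in atTop, a i ≤ b i + c i ∧ b i ≤ a i + c i ∧ c i ≤ a i + b i) →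
      (fun i => (blockDerangementCount₃ (a i) (b i) (c i) : ℝ)) ~[atTop]
        (fun i =>
          (2 : ℝ) ^ (a i + b i + c i + 1) /
              (Real.pi * Real.sqrt
                (2 * (a i : ℝ) * b i + 2 * (a i : ℝ) * c i + 2 * (b i : ℝ) * c i
                  - (a i : ℝ) ^ 2 - (b i : ℝ) ^ 2 - (c i : ℝ) ^ 2)) *
            (((a i).factorial : ℝ) * (b i).factorial * (c i).factorial /
              (((a i + b i - c i).factorial : ℝ) * (a i + c i - b i).factorial
                * (b i + c i - a i).factorial)))) ∧
    (∀ n : ℕ, blockDerangementCount₃ n n n = ∑ k ∈ Finset.range (n + 1), n.choose k ^ 3) ∧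
    (fun n : ℕ => ((∑ k ∈ Finset.range (n + 1), n.choose k ^ 3 : ℕ) : ℝ)) ~[atTop]
      (fun n : ℕ => (2 : ℝ) ^ (3 * n + 1) / (Real.sqrt 3 * Real.pi * n)) :=
  ⟨fun _ _ _ _ _ _ _ hα hβ hγ hN ha hb hc htri =>
      blockDerangementCount₃_isEquivalent hα hβ hγ hN ha hb hc htri,
    blockDerangementCount₃_self, sum_choose_pow_three_isEquivalent⟩
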